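/- Fix an integer $n\ge 2$. A \emph{translation-invariant total order} (TITO) is a total order $\preceq$ on $\mathbb Z$ such that for all $a,b\in\mathbb Z$, $a\preceq b$ if and only if $a+n\preceq b+n$. An \emph{inversion} of $\preceq$ is a pair of integers $a<b$ with $b\preceq a$ (pairs being considered up to simultaneous translation by multiples of $n$), and TITOs are partially ordered by containment of their inversion sets. A TITO is \emph{$312$-avoiding} if there are no integers $a<b<c$ with $c\preceq a\preceq b$. A \emph{block} of a TITO is a nonempty order-convex set $I\subseteq\mathbb Z$ that has no minimal and no maximal element with respect to $\preceq$ and such that $\{b : a\preceq b\preceq c\}$ is finite for all $a,c\in I$; its \emph{size} is the number of residue classes modulo $n$ that it meets. A TITO is \emph{real} if every block $I$ of size $1$ is waxing, that is, satisfies $a\preceq a+n$ for all $a\in I$. The \emph{cyclic Tamari lattice} $\mathsf{CTam}$ is the set of all $312$-avoiding TITOs, and the \emph{affine Tamari lattice} $\mathsf{ATam}$ is the set of all $312$-avoiding real TITOs, both ordered by containment of inversion sets. The length of a chain is one less than its number of elements. \textbf{Theorem.} The maximum length of a maximal chain in $\mathsf{CTam}$ is $\binom{n+1}{2}$, and the maximum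 length of a maximal chain in $\mathsf{ATam}$ is $\binom{n+1}{2}-1$. -/

import Mathlib

/-- A translation-invariant total order (TITO) on the integers, with period `n`. -/
@[ext]
structure TITO (n : ℕ) where
  /-- `rel a b` means that `a` weakly precedes `b`. -/
  rel : ℤ → ℤ → Prop
  refl : ∀ a, rel a a
  antisymm : ∀ a b, rel a b → rel b a → a = b
  trans : ∀ a b c, rel a b → rel b c → rel a c
  total : ∀ a b, rel a b ∨ rel b a
  translate : ∀ a b, rel a b ↔ rel (a + n) (b + n)

namespace TITO

variable {n : ℕ}

/-- The inversion set of a TITO: the pairs `a < b` such that `b` weakly precedes `a`.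
A reflection index is a pair `a < b` up to simultaneous translation by multiples of `n`; this set
is a union of such translation classes (`mem_inv_translate`), so containment of inversion sets is
the same for pairs and for classes of pairs. -/
def Inv (t : TITO n) : Set (ℤ × ℤ) := {p | p.1 < p.2 ∧ t.rel p.2 p.1}

theorem mem_inv_translate (t : TITO n) (a b : ℤ) :
    (a, b) ∈ t.Inv ↔ (a + n, b + n) ∈ t.Inv := by
  have h := t.translate b a
  simp only [Inv, Set.mem_ofPred_eq, add_lt_add_iff_right]
  rw [h]

theorem rel_iff_of_inv_eq {s t : TITO n} (h : s.Inv = t.Inv) (a b : ℤ) :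
    s.rel a b → t.rel a b := by
  intro hs
  rcases lt_trichotomy a b with hab | hab | hab
  · rcases t.total a b with ht | ht
    · exact ht
    · have hm : (a, b) ∈ s.Inv := h ▸ (show (a, b) ∈ t.Inv from ⟨hab, ht⟩)
      exact absurd (s.antisymm a b hs hm.2) hab.ne
  · exact hab ▸ t.refl a
  · have hm : (b, a) ∈ t.Inv := h ▸ (show (b, a) ∈ s.Inv from ⟨hab, hs⟩)
    exact hm.2

/-- The Dyer order: containment of inversion sets. With this order, `TITO n` is the cyclic Dyer
lattice. -/
instance : PartialOrder (TITO n) where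
  le s t := s.Inv ⊆ t.Inv
  le_refl s := Set.Subset.refl s.Inv
  le_trans _ _ _ h₁ h₂ := Set.Subset.trans h₁ h₂
  le_antisymm s t h₁ h₂ := by
    have h : s.Inv = t.Inv := Set.Subset.antisymm h₁ h₂
    ext a b
    exact ⟨rel_iff_of_inv_eq h a b, rel_iff_of_inv_eq h.symm a b⟩

/-- A block of a TITO: a nonempty order-convex set of integers without minimal or maximal element
in which all intervals are finite. -/
structure IsBlock (t : TITO n) (I : Set ℤ) : Prop where
  nonempty : I.Nonempty
  convex : ∀ a b c, a ∈ I → c ∈ I → t.rel a b → t.rel b c → b ∈ I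
  no_min : ∀ a ∈ I, ∃ b ∈ I, b ≠ a ∧ t.rel b a
  no_max : ∀ a ∈ I, ∃ b ∈ I, b ≠ a ∧ t.rel a b
  finite_interval : ∀ a ∈ I, ∀ c ∈ I, {b | t.rel a b ∧ t.rel b c}.Finite

/-- The size of a set of integers: the number of residue classes modulo `n` that it meets. -/
noncomputable def blockSize (n : ℕ) (I : Set ℤ) : ℕ := ((fun a : ℤ => (a : ZMod n)) '' I).ncard

/-- A block is waxing if `a` precedes `a + n` for its elements `a`. -/
def IsWaxing (t : TITO n) (I : Set ℤ) : Prop := ∀ a ∈ I, t.rel a (a + n)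

/-- A TITO is real if every block of size `1` is waxing. -/
def IsReal (t : TITO n) : Prop := ∀ I, t.IsBlock I → blockSize n I = 1 → t.IsWaxing I

/-- There are no `a < b < c` for which `c` precedes `a` and `a` precedes `b`. -/
def Avoids312 (t : TITO n) : Prop :=
  ∀ a b c : ℤ, a < b → b < c → ¬ (t.rel c a ∧ t.rel a b)

end TITO

/-- The Dyer lattice: real TITOs under the Dyer order. -/
abbrev Dyer (n : ℕ) : Type := {t : TITO n // t.IsReal}

/-- The cyclic Tamari lattice: `312`-avoiding TITOs under the Dyer order. -/
abbrev CTam (n : ℕ) : Type := {t : TITO n // t.Avoids312}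

/-- The affine Tamari lattice: `312`-avoiding real TITOs under the Dyer order. -/
abbrev ATam (n : ℕ) : Type := {t : Dyer n // t.1.Avoids312}

/-- The lengths of the maximal chains of a nonempty poset, where the length of a chain is one less
than its number of elements (and is infinite for an infinite chain). -/
def maximalChainLengths (P : Type*) [PartialOrder P] : Set ℕ∞ :=
  {k | ∃ C : Set P, IsMaxChain (· ≤ ·) C ∧ C.encard = k + 1}

/-! In a 312-avoiding order, the `b > a` that precede `a` form an interval starting at `a + 1`, and
they are all of the integers above `a` as soon as `a + n` precedes `a`. Hence the number of waning
residues plus the number of residue pairs with an inversion at distance less than `n` is a strictly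
monotone rank (`card_add_card_lt`), bounded by `n + n.choose 2`. The orders `chainOrder` attain this
bound. A real order cannot have exactly one waning residue (`card_waning_ne_one`), so one rank value
is lost; deleting the single non-real member of the same chain shows that no more is lost. -/

/-- If a poset has a strictly monotone rank with values at most `N` and a strictly increasing
sequence of `N + 1` elements, then `N` is the greatest length of a maximal chain. -/
theorem isGreatest_maximalChainLengths {P : Type*} [PartialOrder P] {N : ℕ} (g : P → ℕ)
    (hg : StrictMono g) (hN : ∀ p, g p ≤ N) (s : Fin (N + 1) → P) (hs : StrictMono s) :
    IsGreatest (maximalChainLengths P) (N : ℕ∞) := by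
  have key : ∀ C : Set P, IsChain (· ≤ ·) C → C.encard ≤ (N : ℕ∞) + 1 := by
    intro C hC
    have hinj : Set.InjOn g C := by
      intro x hx y hy hxy
      by_contra hne
      rcases hC hx hy hne with h | h
      · exact (hg (lt_of_le_of_ne h hne)).ne hxy
      · exact (hg (lt_of_le_of_ne h (Ne.symm hne))).ne hxy.symm
    rw [← hinj.encard_image]
    have hsub : g '' C ⊆ (Finset.range (N + 1) : Set ℕ) := by
      rintro _ ⟨x, -, rfl⟩
      simpa [Nat.lt_succ_iff] using hN x
    refine (Set.encard_le_encard hsub).trans ?_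
    rw [Set.encard_coe_eq_coe_finsetCard, Finset.card_range]
    push_cast
    exact le_rfl
  have hcard : (Set.range s).encard = (N : ℕ∞) + 1 := by
    rw [← Set.image_univ, hs.injective.encard_image]
    simp
  refine ⟨⟨Set.range s, ⟨?_, ?_⟩, hcard⟩, ?_⟩
  · rintro _ ⟨i, rfl⟩ _ ⟨j, rfl⟩ -
    exact (le_total i j).imp (fun h => hs.monotone h) (fun h => hs.monotone h)
  -- No chain has more than `N + 1` elements, so the range of `s` cannot be extended.
  · intro C hC hsub
    exact (Set.finite_range s).eq_of_subset_of_encard_le hsub ((key C hC).trans hcard.ge)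
  · rintro k ⟨C, hC, hk⟩
    have h := key C hC.1
    rw [hk] at h
    exact (ENat.add_le_add_iff_right (by simp)).1 h

namespace TITO

variable {n : ℕ}

/-! ### Inversions of 312-avoiding orders -/

theorem rel_add_mul (t : TITO n) (k : ℤ) (a b : ℤ) :
    t.rel a b ↔ t.rel (a + k * n) (b + k * n) := by
  induction k using Int.induction_on with
  | zero => simp
  | succ k ih =>
    rw [ih, t.translate]
    ring_nf
  | pred k ih =>
    rw [ih, t.translate (a + (-(k : ℤ) - 1) * n)]
    ring_nf

theorem rel_of_le {s t : TITO n} (h : s ≤ t) {a b : ℤ} (hab : a ≤ b) (hs : s.rel b a) :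
    t.rel b a := by
  rcases hab.eq_or_lt with rfl | hab
  · exact t.refl _
  · exact (h (show (a, b) ∈ s.Inv from ⟨hab, hs⟩)).2

theorem exists_rel_of_lt {s t : TITO n} (h : s < t) :
    ∃ a b, a < b ∧ t.rel b a ∧ ¬ s.rel b a := by
  obtain ⟨-, hn⟩ := lt_iff_le_not_ge.1 h
  obtain ⟨⟨a, b⟩, hp, hq⟩ := Set.not_subset.1 hn
  exact ⟨a, b, hp.1, hp.2, fun hs => hq ⟨hp.1, hs⟩⟩

theorem rel_add_mul_self (t : TITO n) {a : ℤ} (h : t.rel (a + n) a) (k : ℕ) :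
    t.rel (a + k * n) a := by
  induction k with
  | zero => simpa using t.refl a
  | succ k ih =>
    refine t.trans _ _ _ ?_ ih
    have := (t.rel_add_mul k _ _).1 h
    convert this using 1
    push_cast
    ring

theorem Avoids312.rel_of_le_of_le {t : TITO n} (ht : t.Avoids312) {a b c : ℤ} (hab : a ≤ b)
    (hbc : b ≤ c) (h : t.rel c a) : t.rel b a := by
  rcases hab.eq_or_lt with rfl | hab
  · exact t.refl _
  rcases hbc.eq_or_lt with rfl | hbc
  · exact h
  exact (t.total b a).resolve_right fun h' => ht a b c hab hbc ⟨h, h'⟩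

theorem Avoids312.rel_of_waning {t : TITO n} (ht : t.Avoids312) (hn : 0 < n) {a b : ℤ}
    (hab : a ≤ b) (h : t.rel (a + n) a) : t.rel b a := by
  refine ht.rel_of_le_of_le hab (c := a + ((b - a).toNat : ℕ) * n) ?_ (t.rel_add_mul_self h _)
  have h1 : (1 : ℤ) ≤ n := by exact_mod_cast hn
  have h2 : ((b - a).toNat : ℤ) = b - a := Int.toNat_of_nonneg (by omega)
  rw [h2]
  nlinarith

/-! ### The rank function -/

open Classical in
/-- The residues `i < n` with `i + n` before `i`. -/
noncomputable def waning (t : TITO n) : Finset ℕ :=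
  {i ∈ Finset.range n | t.rel ((i : ℤ) + n) i}

open Classical in
/-- The pairs `i < j < n` of residues, stored as `⟨j, i⟩`, such that some representatives
at distance less than `n` are inverted. -/
noncomputable def invertedPairs (t : TITO n) : Finset (Σ _ : ℕ, ℕ) :=
  {p ∈ (Finset.range n).sigma Finset.range | t.rel p.1 p.2 ∨ t.rel ((p.2 : ℤ) + n) p.1}

theorem mem_waning {t : TITO n} {i : ℕ} : i ∈ t.waning ↔ i < n ∧ t.rel ((i : ℤ) + n) i := by
  simp [waning]

theorem mem_invertedPairs {t : TITO n} {i j : ℕ} :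
    (⟨j, i⟩ : Σ _ : ℕ, ℕ) ∈ t.invertedPairs ↔
      (j < n ∧ i < j) ∧ (t.rel j i ∨ t.rel ((i : ℤ) + n) j) := by
  simp [invertedPairs]

theorem waning_mono {s t : TITO n} (h : s ≤ t) : s.waning ⊆ t.waning := by
  intro i hi
  rw [mem_waning] at hi ⊢
  exact ⟨hi.1, rel_of_le h (by omega) hi.2⟩

theorem invertedPairs_mono {s t : TITO n} (h : s ≤ t) : s.invertedPairs ⊆ t.invertedPairs := by
  rintro ⟨j, i⟩ hi
  rw [mem_invertedPairs] at hi ⊢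
  exact ⟨hi.1, hi.2.imp (rel_of_le h (by omega)) (rel_of_le h (by omega))⟩

open Classical in
theorem card_waning_le (t : TITO n) : t.waning.card ≤ n :=
  (Finset.card_filter_le _ _).trans (Finset.card_range n).le

open Classical in
theorem card_invertedPairs_le (t : TITO n) : t.invertedPairs.card ≤ n.choose 2 := by
  refine (Finset.card_filter_le _ _).trans ?_
  rw [Finset.card_sigma]
  simp [Finset.sum_range_id, Nat.choose_two_right]

/-- Take an inversion `(a, b)` of `t` only. If the data agree, `a` is waning in neither order, so `b
< a + n`. The pair of residues is then inverted in `s` as well, necessarily through the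
complementary representatives `(b, a + n)`; in `t` both inversions hold and make `a` waning. -/
theorem waning_ne_or_invertedPairs_ne {s t : TITO n} (hn : 0 < n) (hs : s.Avoids312)
    (ht : t.Avoids312) (h : s < t) :
    s.waning ≠ t.waning ∨ s.invertedPairs ≠ t.invertedPairs := by
  by_contra! hst
  obtain ⟨hw, hp⟩ := hst
  obtain ⟨a, b, hab, hb, hnb⟩ := exists_rel_of_lt h
  have hn' : (0 : ℤ) < n := by exact_mod_cast hn
  obtain ⟨i, hi⟩ : ∃ i : ℕ, (i : ℤ) = a % n :=
    ⟨(a % n).toNat, Int.toNat_of_nonneg (Int.emod_nonneg _ hn'.ne')⟩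
  have hin : i < n := by
    have := Int.emod_lt_of_pos a hn'
    omega
  have ha : a + (-(a / n)) * n = i := by
    rw [hi, Int.emod_def]; ring
  rw [t.rel_add_mul (-(a / n)), ha] at hb
  rw [s.rel_add_mul (-(a / n)), ha] at hnb
  have hib : (i : ℤ) < b + (-(a / n)) * n := by omega
  generalize b + (-(a / n)) * n = c at hb hnb hib
  have hnw : ¬ t.rel ((i : ℤ) + n) i := fun hti => by
    have : i ∈ t.waning := mem_waning.2 ⟨hin, hti⟩
    rw [← hw] at this
    exact hnb (hs.rel_of_waning hn hib.le (mem_waning.1 this).2)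
  have hc : c < i + n := by
    by_contra! hc
    exact hnw (ht.rel_of_le_of_le (by omega) hc hb)
  rcases lt_or_ge c n with hcn | hcn
  · lift c to ℕ using by omega
    have : (⟨c, i⟩ : Σ _ : ℕ, ℕ) ∈ t.invertedPairs :=
      mem_invertedPairs.2 ⟨⟨by omega, by omega⟩, Or.inl hb⟩
    rw [← hp] at this
    rcases (mem_invertedPairs.1 this).2 with h1 | h1
    · exact hnb h1
    · exact hnw (t.trans _ _ _ (rel_of_le h.le (by omega) h1) hb)
  -- Here `c` wraps past `n`, so its residue `j` is smaller than `i` and the two clauses of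
  -- `invertedPairs` swap roles.
  · obtain ⟨j, rfl⟩ : ∃ j : ℕ, c = j + n := ⟨(c - n).toNat, by omega⟩
    have : (⟨i, j⟩ : Σ _ : ℕ, ℕ) ∈ t.invertedPairs :=
      mem_invertedPairs.2 ⟨⟨by omega, by omega⟩, Or.inr hb⟩
    rw [← hp] at this
    rcases (mem_invertedPairs.1 this).2 with h1 | h1
    · exact hnw (t.trans _ _ _ ((t.translate _ _).1 (rel_of_le h.le (by omega) h1)) hb)
    · exact hnb h1

theorem card_add_card_lt {s t : TITO n} (hn : 0 < n) (hs : s.Avoids312) (ht : t.Avoids312)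
    (h : s < t) :
    s.waning.card + s.invertedPairs.card < t.waning.card + t.invertedPairs.card := by
  have h1 := Finset.card_le_card (waning_mono h.le)
  have h2 := Finset.card_le_card (invertedPairs_mono h.le)
  rcases waning_ne_or_invertedPairs_ne hn hs ht h with h3 | h3
  · have := Finset.card_lt_card ((waning_mono h.le).ssubset_of_ne h3)
    omega
  · have := Finset.card_lt_card ((invertedPairs_mono h.le).ssubset_of_ne h3)
    omega

/-! ### Real orders and waning classes -/

theorem rel_add_mul_iff_emod (t : TITO n) (a : ℤ) :
    t.rel (a + n) a ↔ t.rel (a % n + n) (a % n) := by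
  have h := t.rel_add_mul (-(a / n)) (a + n) a
  have h1 : a + -(a / n) * n = a % n := by rw [Int.emod_def]; ring
  rwa [add_right_comm, h1] at h

/-- If only one residue class is waning, then it is a block of size `1`. -/
theorem card_waning_ne_one {t : TITO n} (hn : 0 < n) (ht : t.Avoids312) (hr : t.IsReal) :
    t.waning.card ≠ 1 := by
  intro hcard
  have hn' : (0 : ℤ) < n := by exact_mod_cast hn
  obtain ⟨i, hi⟩ := Finset.card_eq_one.1 hcard
  obtain ⟨hin, hwi⟩ := mem_waning.1 (hi ▸ Finset.mem_singleton_self i : i ∈ t.waning)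
  have hw : ∀ a : ℤ, t.rel (a + n) a ↔ (a : ℤ) % n = i := by
    intro a
    rw [rel_add_mul_iff_emod]
    obtain ⟨j, hj⟩ : ∃ j : ℕ, (j : ℤ) = a % n :=
      ⟨(a % n).toNat, Int.toNat_of_nonneg (Int.emod_nonneg _ hn'.ne')⟩
    have hjn : j < n := by
      have := Int.emod_lt_of_pos a hn'
      omega
    rw [← hj]
    have : j ∈ t.waning ↔ j = i := by rw [hi, Finset.mem_singleton]
    rw [mem_waning] at this
    constructor
    · exact fun h => by exact_mod_cast this.1 ⟨hjn, h⟩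
    · exact fun h => (this.2 (by exact_mod_cast h)).2
  set I : Set ℤ := {a | a % n = i} with hI
  have hconv : ∀ a b c, a ∈ I → c ∈ I → t.rel a b → t.rel b c → b ∈ I := by
    intro a b c ha hc hab hbc
    by_contra hb
    have hnb : ¬ t.rel (b + n) b := fun h => hb ((hw b).1 h)
    -- every member of the class that exceeds `b` is after `b`
    have hlate : ∀ x ∈ I, b < x → ¬ t.rel x b := by
      intro x hx hbx hxb
      -- The witness is the member of the class of `x` in `[b, b + n)`: being waning it comes after
      -- `b + n`, and lying between `b` and `x` it comes before `b`.
      refine hnb (t.trans _ _ _ (ht.rel_of_waning hn ?_ ?_)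
        (ht.rel_of_le_of_le (b := b + (x - b) % n) ?_ ?_ hxb))
      · have := Int.emod_lt_of_pos (x - b) hn'
        omega
      · rw [hw]
        have : (b + (x - b) % n) % n = x % n := by
          rw [Int.add_emod_emod]; congr 1; ring
        rw [this]; exact hx
      · have := Int.emod_nonneg (x - b) hn'.ne'
        omega
      · have : (x - b) % n ≤ x - b := by
          rw [Int.emod_def]
          have := Int.ediv_nonneg (a := x - b) (b := n) (by omega) hn'.le
          nlinarith
        omega
    rcases lt_trichotomy b a with h | h | h
    · exact hlate a ha h hab
    · exact hb (h ▸ ha)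
    · have hba := ht.rel_of_waning hn h.le ((hw a).2 ha)
      exact hb (t.antisymm _ _ hba hab ▸ ha)
  have hblock : t.IsBlock I := by
    refine ⟨⟨i, ?_⟩, hconv, ?_, ?_, ?_⟩
    · exact Int.emod_eq_of_lt (by omega) (by omega)
    · intro a ha
      exact ⟨a + n, by simpa [hI] using ha, by omega, (hw a).2 ha⟩
    · intro a ha
      have ha' : a - n ∈ I := by simpa [hI] using ha
      exact ⟨a - n, ha', by omega, by simpa using (hw (a - n)).2 ha'⟩
    · intro a ha c hc
      refine (Set.finite_Icc c a).subset ?_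
      rintro b ⟨hab, hbc⟩
      have hb := hconv a b c ha hc hab hbc
      constructor
      · by_contra! h
        exact h.ne (t.antisymm _ _ hbc (ht.rel_of_waning hn h.le ((hw b).2 hb)))
      · by_contra! h
        exact h.ne (t.antisymm _ _ hab (ht.rel_of_waning hn h.le ((hw a).2 ha)))
  have hsize : blockSize n I = 1 := by
    rw [blockSize, Set.ncard_eq_one]
    refine ⟨((i : ℤ) : ZMod n), ?_⟩
    ext x
    simp only [Set.mem_image, Set.mem_singleton_iff]
    constructor
    · rintro ⟨a, ha, rfl⟩
      rw [ZMod.intCast_eq_intCast_iff']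
      rw [show a % n = i from ha]
      exact (Int.emod_eq_of_lt (by omega) (by omega)).symm
    · rintro rfl
      exact ⟨i, Int.emod_eq_of_lt (by omega) (by omega), rfl⟩
  have hi' : (i : ℤ) ∈ I := Int.emod_eq_of_lt (by omega) (by omega)
  have := t.antisymm _ _ (hr I hblock hsize i hi') hwi
  omega

theorem isReal_of_forall_rel {t : TITO n} (h : ∀ a, t.rel a (a + n)) : t.IsReal :=
  fun _ _ _ a _ => h a

/-- If every waning class has another waning class next to it, then the order is real. -/
theorem isReal_of_waning {t : TITO n} (hn : 0 < n) (ht : t.Avoids312)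
    (h : ∀ a, t.rel (a + n) a → ∃ b, a < b ∧ b < a + n ∧ t.rel (b + n) b) : t.IsReal := by
  intro I hI hsize a ha
  by_contra hna
  have hn' : (0 : ℤ) < n := by exact_mod_cast hn
  have hwa : t.rel (a + n) a := (t.total _ _).resolve_left hna
  obtain ⟨b, hab, hba, hwb⟩ := h a hwa
  obtain ⟨z, hz⟩ := Set.ncard_eq_one.1 hsize
  have hdvd : ∀ x ∈ I, (n : ℤ) ∣ x - a := by
    intro x hx
    have h1 : ((x : ℤ) : ZMod n) = z := by
      have : ((x : ℤ) : ZMod n) ∈ ({z} : Set (ZMod n)) := hz ▸ ⟨x, hx, rfl⟩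
      exact this
    have h2 : ((a : ℤ) : ZMod n) = z := by
      have : ((a : ℤ) : ZMod n) ∈ ({z} : Set (ZMod n)) := hz ▸ ⟨a, ha, rfl⟩
      exact this
    rw [← Int.modEq_iff_dvd, ← ZMod.intCast_eq_intCast_iff, h1, h2]
  obtain ⟨c, hc, hca, hrel⟩ := hI.no_min a ha
  -- The block lies in the class of `a`, which is listed in decreasing order, so a predecessor `c`
  -- of `a` is at least `a + n`. Then `b` falls between `c` and `a` in the order, hence into the
  -- block.
  have hac : a + n ≤ c := by
    obtain ⟨k, hk⟩ := hdvd c hc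
    have hlt : a < c := by
      by_contra! hle
      have hle' : c < a := lt_of_le_of_ne hle hca
      have hwc : t.rel (c + n) c := by
        have := (t.rel_add_mul k _ _).1 hwa
        have h1 : a + k * n = c := by linarith
        rwa [add_right_comm, h1] at this
      exact hca (t.antisymm _ _ hrel (ht.rel_of_waning hn hle hwc))
    have : 0 < k := by
      by_contra! hk0
      nlinarith
    nlinarith
  have hcb : t.rel c b := ht.rel_of_waning hn (by omega) hwb
  have hbI : b ∈ I := hI.convex c b a hc ha hcb (ht.rel_of_waning hn hab.le hwa)
  have := Int.le_of_dvd (by omega) (hdvd b hbI)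
  omega

/-! ### Construction of a longest chain -/

/-- The TITO with a prescribed inversion relation. -/
def ofInv (P : ℤ → ℤ → Prop) (htr : ∀ a b, P a b ↔ P (a + n) (b + n))
    (hint : ∀ a b c, a < b → b < c → P a c → P a b)
    (htrans : ∀ a b c, a < b → b < c → P a b → P b c → P a c) : TITO n where
  rel a b := a = b ∨ (a < b ∧ ¬ P a b) ∨ (b < a ∧ P b a)
  refl a := Or.inl rfl
  antisymm a b h1 h2 := by
    rcases h1 with h | ⟨h, h'⟩ | ⟨h, h'⟩
    · exact h
    · rcases h2 with g | ⟨g, g'⟩ | ⟨g, g'⟩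
      · exact g.symm
      · omega
      · exact absurd g' h'
    · rcases h2 with g | ⟨g, g'⟩ | ⟨g, g'⟩
      · exact g.symm
      · exact absurd h' g'
      · omega
  trans a b c h1 h2 := by
    have e1 := hint a b c
    have e2 := hint a c b
    have e3 := hint b a c
    have e4 := hint b c a
    have e5 := hint c a b
    have e6 := hint c b a
    have f1 := htrans a b c
    have f2 := htrans a c b
    have f3 := htrans b a c
    have f4 := htrans b c a
    have f5 := htrans c a b
    have f6 := htrans c b a
    rcases h1 with rfl | h1
    · exact h2
    rcases h2 with rfl | h2
    · exact Or.inr h1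
    rcases lt_trichotomy a c with hac | rfl | hac
    · refine Or.inr (Or.inl ⟨hac, fun h => ?_⟩)
      rcases h1 with ⟨h1, h1'⟩ | ⟨h1, h1'⟩ <;> rcases h2 with ⟨h2, h2'⟩ | ⟨h2, h2'⟩
      · exact h1' (e1 h1 h2 h)
      · exact h1' (f2 hac h2 h h2')
      · exact h2' (f3 h1 hac h1' h)
      · omega
    · exact Or.inl rfl
    · refine Or.inr (Or.inr ⟨hac, ?_⟩)
      rcases h1 with ⟨h1, h1'⟩ | ⟨h1, h1'⟩ <;> rcases h2 with ⟨h2, h2'⟩ | ⟨h2, h2'⟩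
      · omega
      · exact e5 hac h1 h2'
      · exact absurd (e4 h2 hac h1') h2'
      · exact f6 h2 h1 h2' h1'
  total a b := by
    rcases lt_trichotomy a b with h | h | h
    · by_cases hP : P a b
      · exact Or.inr (Or.inr (Or.inr ⟨h, hP⟩))
      · exact Or.inl (Or.inr (Or.inl ⟨h, hP⟩))
    · exact Or.inl (Or.inl h)
    · by_cases hP : P b a
      · exact Or.inl (Or.inr (Or.inr ⟨h, hP⟩))
      · exact Or.inr (Or.inr (Or.inl ⟨h, hP⟩))
  translate a b := by
    rw [← htr, ← htr]
    simp

/-- The number of pairs `(i, j)` with `i < r` and `i < j < n`. -/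
def staircase (n r : ℕ) : ℕ := ∑ i ∈ Finset.range r, (n - 1 - i)

theorem staircase_succ (n r : ℕ) : staircase n (r + 1) = staircase n r + (n - 1 - r) :=
  Finset.sum_range_succ _ _

theorem staircase_mono (n : ℕ) : Monotone (staircase n) :=
  monotone_nat_of_le_succ fun r => by rw [staircase_succ]; omega

theorem staircase_self (n : ℕ) : staircase n n = n.choose 2 := by
  rw [staircase, Finset.sum_range_reflect (fun i => i) n, Finset.sum_range_id,
    Nat.choose_two_right]

theorem exists_staircase_le {n m : ℕ} (hm : m < n.choose 2) :
    ∃ r < n, staircase n r ≤ m ∧ m < staircase n (r + 1) := by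
  rw [← staircase_self] at hm
  have key : ∀ k, m < staircase n k → ∃ r < k, staircase n r ≤ m ∧ m < staircase n (r + 1) := by
    intro k
    induction k with
    | zero => simp [staircase]
    | succ k ih =>
      intro h
      rcases le_or_gt (staircase n k) m with h' | h'
      · exact ⟨k, by omega, h', h⟩
      · obtain ⟨r, hr, h2⟩ := ih h'
        exact ⟨r, by omega, h2⟩
  exact key n hm

/-- The inversion relation of the `m`-th order in a longest chain. The integers of residue `r`
first gain `n - 1 - r` inversions each, one residue after the other; then the residue classes
become waning, one after the other. -/
def ChainInv (n m : ℕ) (a b : ℤ) : Prop :=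
  a % n + n.choose 2 < m ∨
    -- The truncated subtraction gives `0`, hence no `b > a`, until the turn of the residue comes.
    (b - a ≤ n - 1 - a % n ∧ b - a ≤ ((m - staircase n (a % n).toNat : ℕ) : ℤ))

/-- Unless `a` is waning, `b` lies in the same window of length `n` and has a larger residue.
Residues are served in increasing order, so once `b` has an inversion, `a` already has all those
within its window. -/
theorem ChainInv.trans {m : ℕ} (hn : 0 < n) {a b c : ℤ} (hab : a < b) (hbc : b < c)
    (h1 : ChainInv n m a b) (h2 : ChainInv n m b c) : ChainInv n m a c := by
  rcases h1 with h1 | ⟨h1, h1'⟩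
  · exact Or.inl h1
  have hn' : (0 : ℤ) < n := by exact_mod_cast hn
  have ha := Int.emod_nonneg a hn'.ne'
  have hb : b % n = a % n + (b - a) := by
    have : b % n = (a % n + (b - a)) % n := by
      rw [Int.emod_add_emod]; congr 1; ring
    rw [this]
    exact Int.emod_eq_of_lt (by omega) (by omega)
  rcases h2 with h2 | ⟨h2, h2'⟩
  · exact Or.inl (by omega)
  have h3 := staircase_mono n (show (a % n).toNat + 1 ≤ (b % n).toNat by omega)
  rw [staircase_succ] at h3
  exact Or.inr ⟨by omega, by omega⟩

/-- The `m`-th order in a longest chain. -/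
def chainOrder (hn : 0 < n) (m : ℕ) : TITO n :=
  ofInv (ChainInv n m) (fun a b => by simp [ChainInv])
    (fun a b c _ hbc h => h.imp id fun h => ⟨by omega, by omega⟩)
    (fun _ _ _ hab hbc h1 h2 => h1.trans hn hab hbc h2)

theorem chainOrder_rel (hn : 0 < n) {m : ℕ} {a b : ℤ} (hab : a < b) :
    (chainOrder hn m).rel b a ↔ ChainInv n m a b := by
  constructor
  · rintro (h | ⟨h, -⟩ | ⟨-, h⟩)
    · omega
    · omega
    · exact h
  · exact fun h => Or.inr (Or.inr ⟨hab, h⟩)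

theorem chainOrder_avoids (hn : 0 < n) (m : ℕ) : (chainOrder hn m).Avoids312 := by
  rintro a b c hab hbc ⟨h1, h2⟩
  have hba : (chainOrder hn m).rel b a := by
    rw [chainOrder_rel hn (hab.trans hbc)] at h1
    exact (chainOrder_rel hn hab).2 (h1.imp id fun h => ⟨by omega, by omega⟩)
  exact hab.ne ((chainOrder hn m).antisymm _ _ h2 hba)

theorem chainOrder_mono (hn : 0 < n) : Monotone (chainOrder hn) := by
  rintro m m' hm ⟨a, b⟩ ⟨hab, h⟩
  refine ⟨hab, ?_⟩
  rw [chainOrder_rel hn hab] at h ⊢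
  exact h.imp (fun h => by omega) fun h => ⟨h.1, by omega⟩

theorem chainOrder_lt (hn : 0 < n) {m m' : ℕ} (hm : m < m') (hm' : m' ≤ (n + 1).choose 2) :
    chainOrder hn m < chainOrder hn m' := by
  refine lt_of_lt_of_le (lt_of_le_not_ge (chainOrder_mono hn m.le_succ) fun hle => ?_)
    (chainOrder_mono hn hm)
  have hchoose : (n + 1).choose 2 = n + n.choose 2 := by
    rw [Nat.choose_succ_succ' n 1, Nat.choose_one_right]
  have key : ∀ a b : ℤ, a < b → ChainInv n (m + 1) a b → ChainInv n m a b := fun a b hab h =>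
    (chainOrder_rel hn hab).1 (rel_of_le hle hab.le ((chainOrder_rel hn hab).2 h))
  rcases lt_or_ge m (n.choose 2) with h | h
  · obtain ⟨r, hr, h1, h2⟩ := exists_staircase_le h
    rw [staircase_succ] at h2
    have hmod : (r : ℤ) % n = r := Int.emod_eq_of_lt (by omega) (by omega)
    -- The one inversion that residue `r` gains at this step.
    have := key r (r + ((m - staircase n r : ℕ) + 1)) (by omega)
      (Or.inr (by rw [hmod, Int.toNat_natCast]; omega))
    simp only [ChainInv, hmod, Int.toNat_natCast] at this
    omega
  · have hmod : ((m - n.choose 2 : ℕ) : ℤ) % n = (m - n.choose 2 : ℕ) :=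
      Int.emod_eq_of_lt (by omega) (by omega)
    -- The residue `m - n.choose 2` becomes waning at this step.
    have := key (m - n.choose 2 : ℕ) ((m - n.choose 2 : ℕ) + n) (by omega)
      (Or.inl (by rw [hmod]; omega))
    simp only [ChainInv, hmod] at this
    omega

theorem chainOrder_waning (hn : 0 < n) {m : ℕ} (a : ℤ) :
    (chainOrder hn m).rel (a + n) a ↔ a % n + n.choose 2 < m := by
  have hn' : (0 : ℤ) < n := by exact_mod_cast hn
  rw [chainOrder_rel hn (by omega), ChainInv]
  have := Int.emod_nonneg a hn'.ne'
  constructor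
  · rintro (h | ⟨h, -⟩)
    · exact h
    · omega
  · exact Or.inl

theorem chainOrder_isReal (hn : 2 ≤ n) {m : ℕ} (hm : m ≠ n.choose 2 + 1) :
    (chainOrder (by omega : 0 < n) m).IsReal := by
  have hn0 : 0 < n := by omega
  have hn' : (0 : ℤ) < n := by exact_mod_cast hn0
  rcases lt_or_ge m (n.choose 2 + 1) with h | h
  · refine isReal_of_forall_rel fun a => ((chainOrder hn0 m).total _ _).resolve_right fun h' => ?_
    rw [chainOrder_waning] at h'
    have := Int.emod_nonneg a hn'.ne'
    omega
  · refine isReal_of_waning hn0 (chainOrder_avoids hn0 m) fun a ha => ?_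
    have h0 := Int.emod_nonneg a hn'.ne'
    have h1 := Int.emod_lt_of_pos a hn'
    rcases h0.eq_or_lt with h2 | h2
    -- Residues `0` and `1` are both waning here: `1` serves as neighbour for residue `0`, and `0`
    -- for all the others.
    · refine ⟨a + 1, by omega, by omega, (chainOrder_waning hn0 _).2 ?_⟩
      have : (a + 1) % n = 1 := by
        rw [← Int.emod_add_emod, ← h2]
        exact Int.emod_eq_of_lt (by omega) (by omega)
      omega
    · refine ⟨a + (n - a % n), by omega, by omega, (chainOrder_waning hn0 _).2 ?_⟩
      have : (a + (n - a % n)) % n = 0 := by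
        rw [← Int.emod_add_emod]
        simp
      omega

end TITO

/-! ### The two maximum lengths -/

theorem mainTheorem1 (n : ℕ) (hn : 2 ≤ n) :
    IsGreatest (maximalChainLengths (CTam n)) (((n + 1).choose 2 : ℕ) : ℕ∞) ∧
      IsGreatest (maximalChainLengths (ATam n)) (((n + 1).choose 2 - 1 : ℕ) : ℕ∞) := by
  have hn0 : 0 < n := by omega
  have hchoose : (n + 1).choose 2 = n + n.choose 2 := by
    rw [Nat.choose_succ_succ' n 1, Nat.choose_one_right]
  constructor
  · refine isGreatest_maximalChainLengths
      (fun t => t.1.waning.card + t.1.invertedPairs.card)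
      (fun s t h => TITO.card_add_card_lt hn0 s.2 t.2 h) (fun t => ?_)
      (fun k => ⟨TITO.chainOrder hn0 k, TITO.chainOrder_avoids hn0 k⟩)
      (fun k l h => TITO.chainOrder_lt hn0 h (by omega))
    have h1 := t.1.card_waning_le
    have h2 := t.1.card_invertedPairs_le
    omega
  · refine isGreatest_maximalChainLengths
      -- Truncation sends both `0` and `1` to `0`; strictness survives because the value `1` never
      -- occurs.
      (fun t => (t.1.1.waning.card - 1) + t.1.1.invertedPairs.card)
      (fun s t h => ?_) (fun t => ?_)
      -- The index skips `n.choose 2 + 1`, where exactly one residue is waning.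
      (fun k => ⟨⟨TITO.chainOrder hn0 (if k.1 ≤ n.choose 2 then k.1 else k.1 + 1),
        TITO.chainOrder_isReal hn (by split_ifs <;> omega)⟩, TITO.chainOrder_avoids hn0 _⟩)
      (fun k l h => TITO.chainOrder_lt hn0 ?_ ?_)
    · have hlt : s.1.1 < t.1.1 := h
      have h1 := Finset.card_le_card (TITO.waning_mono hlt.le)
      have h2 := Finset.card_le_card (TITO.invertedPairs_mono hlt.le)
      have h3 := TITO.card_add_card_lt hn0 s.2 t.2 hlt
      have h4 := TITO.card_waning_ne_one hn0 s.2 s.1.2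
      have h5 := TITO.card_waning_ne_one hn0 t.2 t.1.2
      simp only
      omega
    · have h1 := t.1.1.card_waning_le
      have h2 := t.1.1.card_invertedPairs_le
      omega
    · have : k.1 < l.1 := h
      split_ifs <;> omega
    · have := l.2
      split_ifs <;> omega
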